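/- **Theorem.** Consider Markov decision processes (MDPs) $(\mathcal X,\mathcal A,p,\gamma,\mathcal R)$ with finite state space $\mathcal X$, finite action space $\mathcal A$, transition kernel $p$, discount factor $\gamma\in[0,1)$ and reward distributions $\mathcal R(x,a)\in\mathscr P(\mathbb R)$. For a Markov policy $\pi:\mathcal X\to\mathscr P(\mathcal A)$ let $\eta^\pi(x,a)$ be the law of the return $\sum_{t\ge 0}\gamma^tR_t$ given $X_0=x$, $A_0=a$, where $R_t\sim\mathcal R(X_t,A_t)$, $X_{t+1}\sim p(\cdot\mid X_t,A_t)$ and $A_{t+1}\sim\pi(\cdot\mid X_{t+1})$. Let $h_1,\dots,h_K:\mathbb R\to\mathbb R$ be Borel measurable, and let $s_k(\mu)=\mathbb E_{Z\sim\mu}[h_k(Z)]$, defined for those $\mu\in\mathscr P(\mathbb R)$ for which $h_k$ is $\mu$-integrable. Write $s_{1:K}=(s_1,\dots,s_K)$, and let $D$ be the set of $\mu\in\mathscr P(\mathbb R)$ for which all of $s_1,\dots,s_K$ are defined. Suppose that $s_1,\dots,s_K$ are *Bellman closed*: there is a function $T$, not depending on the MDP or the policy, such that for every MDP and every policy $\pi$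 for which the return series converges almost surely from every state-action pair and all return distributions lie in $D$, and for every $(x,a)\in\mathcal X\times\mathcal A$, the vector $s_{1:K}(\eta^\pi(x,a))$ equals $T$ applied to $\gamma$ and the joint law of $R_0$ and $s_{1:K}(\eta^\pi(X_1,A_1))$ given $X_0=x$, $A_0=a$. Then there is an integer $0\le L\le K$ such that $D$ is exactly the set of $\mu\in\mathscr P(\mathbb R)$ for which the moments $\mathbb E_{Z\sim\mu}[Z^l]$, $l=0,\dots,L$, are defined (that is, $z\mapsto z^l$ is $\mu$-integrable), and, as real linear spaces of functionals on $D$, $$\operatorname{span}\{s_0,s_1,\dots,s_K\}=\operatorname{span}\{\mu\mapsto\mathbb E_{Z\sim\mu}[Z^l] : l=0,\dots,L\},$$ where $s_0$ is the constant functional equal to $1$. -/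

import Mathlib

open MeasureTheory ProbabilityTheory

noncomputable section

namespace DistRL

/-! ### Markov decision processes and their return distributions -/

/-- A Markov decision process `(X, A, p, γ, R)` with state space `X` and action space `A`.
Finiteness of `X` and `A`, and discreteness of their σ-algebras, is required where MDPs are
quantified over; every function into the probability measures is then a Markov kernel. -/
structure MDP (X A : Type) [MeasurableSpace X] [MeasurableSpace A] where
  /-- the transition kernel: `trans (x, a)` is the law of the next state -/
  trans : Kernel (X × A) X
  /-- `reward (x, a)` is the law of the immediate reward -/
  reward : Kernel (X × A) ℝ
  /-- the discount factor -/
  γ : ℝ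
  γ_nonneg : 0 ≤ γ
  γ_lt_one : γ < 1
  markov_trans : IsMarkovKernel trans
  markov_reward : IsMarkovKernel reward

attribute [instance] MDP.markov_trans MDP.markov_reward

/-- One time step of a trajectory: the pair `(X_t, A_t)` together with the reward `R_t`. -/
abbrev Step (X A : Type) : Type := (X × A) × ℝ

/-- The state `X_t` at time `t`. -/
abbrev stateAt {X A : Type} (t : ℕ) (ω : ℕ → Step X A) : X := (ω t).1.1

/-- The action `A_t` at time `t`. -/
abbrev actionAt {X A : Type} (t : ℕ) (ω : ℕ → Step X A) : A := (ω t).1.2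

/-- The reward `R_t` at time `t`. -/
abbrev rewardAt {X A : Type} (t : ℕ) (ω : ℕ → Step X A) : ℝ := (ω t).2

namespace MDP

variable {X A : Type} [MeasurableSpace X] [MeasurableSpace A]

/-- Law of `(X_{t+1}, A_{t+1}, R_{t+1})` given `(X_t, A_t)`:
`X_{t+1} ∼ p(· | X_t, A_t)`, `A_{t+1} ∼ π(· | X_{t+1})`, `R_{t+1} ∼ R(X_{t+1}, A_{t+1})`. -/
def stepKernel (M : MDP X A) (π : Kernel X A) : Kernel (X × A) (Step X A) :=
  (M.trans ⊗ₖ Kernel.prodMkLeft (X × A) π) ⊗ₖ Kernel.prodMkLeft (X × A) M.reward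

instance (M : MDP X A) (π : Kernel X A) [IsMarkovKernel π] :
    IsMarkovKernel (M.stepKernel π) := by
  unfold stepKernel; infer_instance

/-- The next step given the whole history up to time `n`; it only depends on `(X_n, A_n)`. -/
def historyKernel (M : MDP X A) (π : Kernel X A) (n : ℕ) :
    Kernel (Π _ : Finset.Iic n, Step X A) (Step X A) :=
  (M.stepKernel π).comap (fun h => (h ⟨n, Finset.mem_Iic.2 le_rfl⟩).1) (by fun_prop)

instance (M : MDP X A) (π : Kernel X A) [IsMarkovKernel π] (n : ℕ) :
    IsMarkovKernel (M.historyKernel π n) := by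
  unfold historyKernel; infer_instance

/-- The law of the trajectory `(X_t, A_t, R_t)_{t ≥ 0}` under the policy `π`, given `X_0 = x` and
`A_0 = a`. -/
def trajLaw (M : MDP X A) (π : Kernel X A) [IsMarkovKernel π] (x : X) (a : A) :
    Measure (ℕ → Step X A) :=
  Kernel.trajMeasure (X := fun _ : ℕ => Step X A)
    ((Measure.dirac (x, a)).prod (M.reward (x, a))) (M.historyKernel π)

instance (M : MDP X A) (π : Kernel X A) [IsMarkovKernel π] (x : X) (a : A) :
    IsProbabilityMeasure (M.trajLaw π x a) := by
  unfold trajLaw; infer_instance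

/-- The random return `∑ t, γ ^ t * R_t` of a trajectory. -/
def ret (M : MDP X A) (ω : ℕ → Step X A) : ℝ := ∑' t : ℕ, M.γ ^ t * rewardAt t ω

theorem measurable_ret (M : MDP X A) : Measurable M.ret :=
  Measurable.tsum fun t => by unfold rewardAt; fun_prop

/-- The return distribution `η^π(x, a)`. -/
def returnDist (M : MDP X A) (π : Kernel X A) [IsMarkovKernel π] (x : X) (a : A) :
    ProbabilityMeasure ℝ :=
  ⟨(M.trajLaw π x a).map M.ret, Measure.isProbabilityMeasure_map M.measurable_ret.aemeasurable⟩

/-- The random return is almost surely a convergent series, from every state-action pair. -/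
def ReturnConverges (M : MDP X A) (π : Kernel X A) [IsMarkovKernel π] : Prop :=
  ∀ x a, ∀ᵐ ω ∂(M.trajLaw π x a), Summable fun t : ℕ => M.γ ^ t * rewardAt t ω

end MDP

/-! ### Statistics -/

/-- A statistic: a real-valued function on a set of probability distributions on `ℝ`.
The values of `val` outside of `dom` carry no meaning. -/
structure Statistic where
  /-- the distributions for which the statistic is defined -/
  dom : Set (ProbabilityMeasure ℝ)
  /-- the value of the statistic -/
  val : ProbabilityMeasure ℝ → ℝ

/-- The statistic `μ ↦ E_{Z ∼ μ}[h Z]`, defined for those `μ` for which `h` is integrable. -/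
def Statistic.expectation (h : ℝ → ℝ) : Statistic where
  dom := {μ | Integrable h (μ : Measure ℝ)}
  val μ := ∫ z, h z ∂(μ : Measure ℝ)

/-- The moment functional `μ ↦ E_{Z ∼ μ}[Z ^ l]`. -/
def Statistic.moment (l : ℕ) : Statistic := Statistic.expectation fun z => z ^ l

/-- The distributions for which every statistic of a family is defined. -/
def commonDom {ι : Type} (s : ι → Statistic) : Set (ProbabilityMeasure ℝ) :=
  {μ | ∀ i, μ ∈ (s i).dom}

/-- The vector of values `s_{1:K}(μ)`. -/
def statVec {K : ℕ} (s : Fin K → Statistic) (μ : ProbabilityMeasure ℝ) : Fin K → ℝ :=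
  fun k => (s k).val μ

/-- The joint law of `(R_0, s_{1:K}(η^π(X_1, A_1)))` given `X_0 = x`, `A_0 = a`. -/
def nextLaw {X A : Type} [MeasurableSpace X] [MeasurableSpace A] {K : ℕ} (s : Fin K → Statistic)
    (M : MDP X A) (π : Kernel X A) [IsMarkovKernel π] (x : X) (a : A) :
    Measure (ℝ × (Fin K → ℝ)) :=
  (M.trajLaw π x a).map fun ω =>
    (rewardAt 0 ω, statVec s (M.returnDist π (stateAt 1 ω) (actionAt 1 ω)))

/-- Bellman closedness: there is one function `T`, the same for all MDPs and policies, that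
expresses `s_{1:K}(η^π(x, a))` through the discount factor and the random variables `R_0` and
`s_{1:K}(η^π(X_1, A_1))` given `X_0 = x`, `A_0 = a`, that is, through their joint law. It ranges
over the finite MDPs and policies for which the returns exist and the statistics are defined at
all return distributions. -/
def BellmanClosed {K : ℕ} (s : Fin K → Statistic) : Prop :=
  ∃ T : ℝ → Measure (ℝ × (Fin K → ℝ)) → (Fin K → ℝ),
    ∀ (X A : Type) [Finite X] [Finite A] [MeasurableSpace X] [MeasurableSpace A]
      [MeasurableSingletonClass X] [MeasurableSingletonClass A]
      (M : MDP X A) (π : Kernel X A) [IsMarkovKernel π],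
      M.ReturnConverges π →
      (∀ x a, M.returnDist π x a ∈ commonDom s) →
      ∀ x a, statVec s (M.returnDist π x a) = T M.γ (nextLaw s M π x a)

/-- A family of statistics as a family of real functionals on a set `D` of distributions. -/
def functionalsOn {ι : Type} (D : Set (ProbabilityMeasure ℝ)) (s : ι → Statistic) :
    ι → D → ℝ :=
  fun i μ => (s i).val μ

end DistRL

end

/-!
Let `V` be the linear span of `1, h₁, …, h_K` in the space of all functions `ℝ → ℝ`. Linear
relations between functionals and questions of integrability can both be read off from `V`
(`integral_mem_span`), so it is enough to prove that `V` is the space of polynomials of degree at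
most `L` for some `L`; then `L + 1 = dim V ≤ K + 1`.

A three-state deterministic chain (`chainMDP`), whose reward in the middle state has an arbitrary
finitely supported law `ν`, shows that the statistics of the law of `γ Z + r` with `Z ∼ ν` are
determined by those of `ν`. By duality between functions and finitely supported measures, `V` is
stable under `f ↦ f (γ · + r)` (`mem_span_of_forall_atomic`), and, being finite-dimensional, under
composition with all increasing affine maps (`BellmanClosed.affineInvariant_span`).

It remains to find the finite-dimensional affine-invariant spaces `V` of measurable functions that
contain `1` (`AffineInvariant.exists_eq_span_pow`). A Steinhaus argument makes all functions in `V`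
continuous (`AffineInvariant.continuous`). Dilations conjugate the translation `T₁` on `V` to `T_t`
for all `t > 0`, and `T_t → 1` as `t → 0`, so `T₁` has the characteristic polynomial of the identity
and `T₁ - 1` is nilpotent. By Newton's formula the functions in `V` agree with polynomials on `ℕ`,
by dilation on the nonnegative rationals, by continuity and translation on all of `ℝ`. Finally,
dilations separate the terms of a polynomial, and translating `x ^ L` by `1` produces all lower
powers.
-/

namespace DistRL

/-! ### Affine-invariant function spaces -/

section AffineInvariantSpaces

open Filter Topology Polynomial

/-- If `φ (s - t)` is a continuous function of `Ψ s` and `Ψ t`, where `Ψ` is measurable with values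
in a second-countable space, then `φ` is continuous at `0`. Countably many sets `Ψ ⁻¹' O`, on whose
differences `φ` stays in a given neighbourhood of `φ 0`, cover `ℝ`; one of them has positive
measure, and by Steinhaus' theorem its differences form a neighbourhood of `0`. -/
theorem continuousAt_zero_of_measurable {X Y : Type*} [TopologicalSpace X]
    [SecondCountableTopology X] [MeasurableSpace X] [OpensMeasurableSpace X] [TopologicalSpace Y]
    {Ψ : ℝ → X} (hΨ : Measurable Ψ) {m : X × X → Y} (hm : Continuous m) {φ : ℝ → Y}
    (hφ : ∀ s t, φ (s - t) = m (Ψ s, Ψ t)) : ContinuousAt φ 0 := by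
  intro U hU
  have hO : ∀ s, ∃ O : Set X, IsOpen O ∧ Ψ s ∈ O ∧ ∀ x ∈ O, ∀ y ∈ O, m (x, y) ∈ U := by
    intro s
    have h0 : m (Ψ s, Ψ s) = φ 0 := by rw [← hφ, sub_self]
    have h1 : m ⁻¹' U ∈ 𝓝 (Ψ s, Ψ s) := hm.continuousAt (by rwa [h0])
    rw [nhds_prod_eq, mem_prod_same_iff] at h1
    obtain ⟨t, ht, htU⟩ := h1
    obtain ⟨O, hOt, hO, hs⟩ := mem_nhds_iff.1 ht
    exact ⟨O, hO, hs, fun x hx y hy => htU (Set.mk_mem_prod (hOt hx) (hOt hy))⟩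
  choose O hO hsO hOU using hO
  obtain ⟨C, hC, hCU⟩ := TopologicalSpace.isOpen_iUnion_countable O hO
  obtain ⟨s, hs⟩ : ∃ s, 0 < volume (Ψ ⁻¹' O s) := by
    by_contra! hcon
    have : (volume : Measure ℝ) Set.univ = 0 := by
      refine measure_mono_null (t := ⋃ s ∈ C, Ψ ⁻¹' O s) (fun t _ => ?_)
        ((measure_biUnion_null_iff hC).2 fun s _ => le_antisymm (hcon s) bot_le)
      have : Ψ t ∈ ⋃ s ∈ C, O s := hCU ▸ Set.mem_iUnion.2 ⟨t, hsO t⟩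
      simpa using this
    simp at this
  have := Measure.sub_mem_nhds_zero_of_addHaar_pos volume _ (hΨ (hO s).measurableSet) hs
  refine Filter.mem_map.2 (mem_of_superset this ?_)
  rintro _ ⟨a, ha, b, hb, rfl⟩
  simpa [hφ] using hOU s _ ha _ hb

theorem eq_of_forall_nat_eval_eq {p q : ℝ[X]} {c : ℕ}
    (h : ∀ m : ℕ, c ≤ m → p.eval (m : ℝ) = q.eval (m : ℝ)) : p = q := by
  refine Polynomial.eq_of_infinite_eval_eq p q (Set.Infinite.mono ?_
    ((Set.Ici_infinite c).image (Nat.cast_injective (R := ℝ)).injOn))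
  rintro _ ⟨m, hm, rfl⟩
  exact h m hm

theorem linearIndependent_pow_fun : LinearIndependent ℝ fun (l : ℕ) (x : ℝ) => x ^ l := by
  let ev : ℝ[X] →ₗ[ℝ] ℝ → ℝ := LinearMap.pi Polynomial.leval
  have h := (Polynomial.basisMonomials ℝ).linearIndependent.map' ev
    (LinearMap.ker_eq_bot.2 fun p q hpq => Polynomial.funext fun x => congrFun hpq x)
  have he : (fun (l : ℕ) (x : ℝ) => x ^ l) = ev ∘ Polynomial.basisMonomials ℝ := by
    ext l x
    simp [ev, Polynomial.leval]
  rw [he]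
  exact h

/-- A space of real functions is affine invariant if it is stable under composition with every
increasing affine map. -/
structure AffineInvariant (V : Submodule ℝ (ℝ → ℝ)) : Prop where
  comp_mem : ∀ f ∈ V, ∀ a : ℝ, 0 < a → ∀ b : ℝ, (fun x => f (a * x + b)) ∈ V

/-- Evaluation at `x`, as a linear form on a space of functions. -/
def evalOn (V : Submodule ℝ (ℝ → ℝ)) (x : ℝ) : V →ₗ[ℝ] ℝ := (LinearMap.proj x).comp V.subtype

theorem evalOn_apply (V : Submodule ℝ (ℝ → ℝ)) (x : ℝ) (f : V) : evalOn V x f = f.1 x := rfl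

/-- Evaluations separate functions, so they span the dual of a finite-dimensional function space. This
transfers measurability and continuity from `f` to the coordinates of its translates. -/
theorem dual_mem_span_evalOn (V : Submodule ℝ (ℝ → ℝ)) [FiniteDimensional ℝ V] (ψ : V →ₗ[ℝ] ℝ) :
    ψ ∈ Submodule.span ℝ (Set.range (evalOn V)) := by
  refine FiniteDimensional.mem_span_of_iInf_ker_le_ker fun f hf => ?_
  have : f = 0 := by
    ext x
    simpa [evalOn_apply] using (Submodule.mem_iInf _).1 hf x
  simp [this]

namespace AffineInvariant
variable {V : Submodule ℝ (ℝ → ℝ)}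

theorem shift_mem (hV : AffineInvariant V) {f : ℝ → ℝ} (hf : f ∈ V) (b : ℝ) :
    (fun x => f (x + b)) ∈ V := by
  simpa using hV.comp_mem f hf 1 one_pos b

theorem dilate_mem (hV : AffineInvariant V) {f : ℝ → ℝ} (hf : f ∈ V) {a : ℝ} (ha : 0 < a) :
    (fun x => f (a * x)) ∈ V := by
  simpa using hV.comp_mem f hf a ha 0

variable (hV : AffineInvariant V)

/-- Translation by `t`, `f ↦ f (· + t)`, on an affine-invariant space. -/
def shift (t : ℝ) : Module.End ℝ V :=
  (LinearMap.funLeft ℝ ℝ fun x => x + t).restrict fun _ hf => hV.shift_mem hf t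

theorem shift_apply (t : ℝ) (f : V) (x : ℝ) : (hV.shift t f).1 x = f.1 (x + t) := rfl

/-- Dilation by `a`, `f ↦ f (a * ·)`, on an affine-invariant space. -/
def dilate (a : ℝ) (ha : 0 < a) : Module.End ℝ V :=
  (LinearMap.funLeft ℝ ℝ fun x => a * x).restrict fun _ hf => hV.dilate_mem hf ha

theorem dilate_apply (a : ℝ) (ha : 0 < a) (f : V) (x : ℝ) :
    (hV.dilate a ha f).1 x = f.1 (a * x) := rfl

theorem shift_zero : hV.shift 0 = 1 := by
  ext f x; simp [shift_apply]

theorem shift_one_pow_apply (m : ℕ) (f : V) (x : ℝ) : ((hV.shift 1 ^ m) f).1 x = f.1 (x + m) := by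
  induction m generalizing f with
  | zero => simp
  | succ m ih =>
    rw [pow_succ, Module.End.mul_apply, ih, shift_apply]
    push_cast; ring_nf

theorem measurable_dual_shift [FiniteDimensional ℝ V] (hm : ∀ f ∈ V, Measurable f)
    (ψ : V →ₗ[ℝ] ℝ) (f : V) : Measurable fun t => ψ (hV.shift t f) := by
  induction dual_mem_span_evalOn V ψ using Submodule.span_induction with
  | mem ψ h =>
    obtain ⟨x, rfl⟩ := h
    exact (hm f f.2).comp (measurable_const_add x)
  | zero => simp
  | add ψ ψ' _ _ h h' => exact h.add h'
  | smul c ψ _ h => exact h.const_mul c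

theorem continuous_dual_shift [FiniteDimensional ℝ V] {f : V} (hf : Continuous f.1)
    (ψ : V →ₗ[ℝ] ℝ) : Continuous fun t => ψ (hV.shift t f) := by
  induction dual_mem_span_evalOn V ψ using Submodule.span_induction with
  | mem ψ h =>
    obtain ⟨x, rfl⟩ := h
    exact hf.comp (continuous_const_add x)
  | zero => simpa using continuous_const
  | add ψ ψ' _ _ h h' => exact h.add h'
  | smul c ψ _ h => exact continuous_const.mul h

include hV in
/-- The functions of a finite-dimensional affine-invariant space of measurable functions are
continuous: in a basis `b`, `g (s - t)` is the sum over `i` of the `i`-th coordinate of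
`g (· - t)` times `b i s`, so that `continuousAt_zero_of_measurable` applies. -/
theorem continuous [FiniteDimensional ℝ V] (hm : ∀ f ∈ V, Measurable f) {f : ℝ → ℝ} (hf : f ∈ V) :
    Continuous f := by
  have key : ∀ g : V, ContinuousAt g.1 0 := by
    intro g
    let b := Module.finBasis ℝ V
    let Ψ : ℝ → (Fin (Module.finrank ℝ V) → ℝ) × (Fin (Module.finrank ℝ V) → ℝ) :=
      fun t => (fun i => (b i).1 t, fun i => b.repr (hV.shift (-t) g) i)
    have hΨ : Measurable Ψ := by
      refine Measurable.prodMk (measurable_pi_lambda _ fun i => hm _ (b i).2)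
        (measurable_pi_lambda _ fun i => ?_)
      exact (hV.measurable_dual_shift hm (b.coord i) g).comp measurable_neg
    refine continuousAt_zero_of_measurable hΨ (m := fun p => ∑ i, p.2.2 i * p.1.1 i)
      (by fun_prop) fun s t => ?_
    have h := congrArg (evalOn V s) (b.sum_repr (hV.shift (-t) g))
    rw [map_sum] at h
    simpa [evalOn_apply, shift_apply, Ψ, sub_eq_add_neg] using h.symm
  refine continuous_iff_continuousAt.2 fun x => ?_
  have h1 := key (hV.shift x ⟨f, hf⟩)
  have h2 : ContinuousAt (fun y => f (y + x)) (x - x) := by rw [sub_self]; exact h1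
  have h3 : ContinuousAt (fun y : ℝ => y - x) x := by fun_prop
  simpa [Function.comp_def] using ContinuousAt.comp (f := fun y : ℝ => y - x) h2 h3

/-- Dilations conjugate translations into each other. -/
theorem charpoly_shift_eq [FiniteDimensional ℝ V] {a : ℝ} (ha : 0 < a) (t : ℝ) :
    (hV.shift t).charpoly = (hV.shift (a * t)).charpoly := by
  have h1 : hV.dilate a ha * hV.dilate a⁻¹ (inv_pos.2 ha) = 1 := by
    ext f x
    simp [dilate_apply, ha.ne']
  have hd : LinearMap.det (hV.dilate a ha) ≠ 0 := by
    intro h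
    have := congrArg LinearMap.det h1
    simp [h] at this
  refine Polynomial.funext fun x => ?_
  rw [LinearMap.eval_charpoly, LinearMap.eval_charpoly]
  have h2 : (algebraMap ℝ (Module.End ℝ V) x - hV.shift t) * hV.dilate a ha =
      hV.dilate a ha * (algebraMap ℝ (Module.End ℝ V) x - hV.shift (a * t)) := by
    ext f y
    simp [dilate_apply, shift_apply, Module.algebraMap_end_apply, mul_add]
  have h3 := congrArg LinearMap.det h2
  rw [map_mul, map_mul, mul_comm] at h3
  exact mul_left_cancel₀ hd h3

/-- Translation by `1` is conjugate to translation by each `t > 0`, which tends to the identity as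
`t → 0`. -/
theorem charpoly_shift_one [FiniteDimensional ℝ V] (hm : ∀ f ∈ V, Measurable f) :
    (hV.shift 1).charpoly = (1 : Module.End ℝ V).charpoly := by
  refine Polynomial.funext fun x => ?_
  let b := Module.finBasis ℝ V
  have hc : Continuous fun t => (hV.shift t).charpoly.eval x := by
    simp_rw [LinearMap.eval_charpoly, ← LinearMap.det_toMatrix b]
    refine Continuous.matrix_det (continuous_matrix fun i j => ?_)
    simp only [LinearMap.toMatrix_apply, LinearMap.sub_apply, map_sub, Finsupp.sub_apply]
    exact continuous_const.sub
      (hV.continuous_dual_shift (hV.continuous hm (b j).2) (b.coord i))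
  have h0 : Tendsto (fun t => (hV.shift t).charpoly.eval x) (𝓝[>] 0)
      (𝓝 ((1 : Module.End ℝ V).charpoly.eval x)) := by
    rw [← hV.shift_zero]
    exact hc.continuousAt.tendsto.mono_left nhdsWithin_le_nhds
  refine tendsto_nhds_unique (Tendsto.congr' ?_ tendsto_const_nhds) h0
  filter_upwards [self_mem_nhdsWithin] with t ht
  rw [hV.charpoly_shift_eq ht 1, mul_one]

/-- Translation by `1` is unipotent, by the Cayley–Hamilton theorem. -/
theorem shift_one_sub_one_pow [FiniteDimensional ℝ V] (hm : ∀ f ∈ V, Measurable f) :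
    (hV.shift 1 - 1) ^ Module.finrank ℝ V = 0 := by
  have h := (hV.shift 1).aeval_self_charpoly
  rw [hV.charpoly_shift_one hm, LinearMap.charpoly_one] at h
  simpa using h

include hV in
/-- Newton's formula `f m = ∑ k, choose m k * (Δ ^ k f) 0` is a finite sum with a bound on `k`
independent of `m`, because the difference operator `Δ` is nilpotent. -/
theorem exists_polynomial_nat [FiniteDimensional ℝ V] (hm : ∀ f ∈ V, Measurable f)
    {f : ℝ → ℝ} (hf : f ∈ V) : ∃ p : ℝ[X], ∀ m : ℕ, f m = p.eval (m : ℝ) := by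
  set n := Module.finrank ℝ V
  let N : Module.End ℝ V := hV.shift 1 - 1
  have hN : ∀ k, n ≤ k → N ^ k = 0 := fun k hk => by
    rw [← Nat.add_sub_cancel' hk, pow_add, hV.shift_one_sub_one_pow hm, zero_mul]
  refine ⟨∑ k ∈ Finset.range n,
    C (((N ^ k) ⟨f, hf⟩).1 0 / k.factorial) * descPochhammer ℝ k, fun m => ?_⟩
  have h1 : hV.shift 1 ^ m = ∑ k ∈ Finset.range (m + 1), N ^ k * (m.choose k : Module.End ℝ V) := by
    have : hV.shift 1 = N + 1 := (sub_add_cancel (hV.shift 1) 1).symm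
    rw [this, (Commute.one_right N).add_pow]
    simp
  have h2 : f m = ∑ k ∈ Finset.range (m + 1), (m.choose k : ℝ) * ((N ^ k) ⟨f, hf⟩).1 0 := by
    have := hV.shift_one_pow_apply m ⟨f, hf⟩ 0
    rw [h1, zero_add] at this
    refine this.symm.trans ?_
    rw [← evalOn_apply, LinearMap.sum_apply, map_sum]
    refine Finset.sum_congr rfl fun k _ => ?_
    rw [Module.End.mul_apply, Module.End.natCast_apply, map_nsmul, map_nsmul, nsmul_eq_mul]
    rfl
  have h3 : ∀ k, (m.choose k : ℝ) * ((N ^ k) ⟨f, hf⟩).1 0 =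
      (C (((N ^ k) ⟨f, hf⟩).1 0 / k.factorial) * descPochhammer ℝ k).eval (m : ℝ) := by
    intro k
    rw [eval_mul, eval_C, descPochhammer_eval_eq_descFactorial,
      Nat.descFactorial_eq_factorial_mul_choose]
    have : (k.factorial : ℝ) ≠ 0 := by positivity
    push_cast
    field_simp
  rw [h2, eval_finsetSum]
  simp_rw [← h3]
  -- both sums agree with the sum over `k < max (m + 1) n`
  rw [Finset.sum_subset (Finset.range_mono (le_max_left (m + 1) n)),
    Finset.sum_subset (Finset.range_mono (le_max_right (m + 1) n))]
  · intro k _ hk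
    simp [hN k (by simpa using hk)]
  · intro k _ hk
    simp [Nat.choose_eq_zero_of_lt (show m < k by simpa using hk)]

include hV in
/-- Dilating by `1 / (q + 1)` extends the polynomial from the natural numbers to the nonnegative
rationals, and continuity extends it to the nonnegative reals. -/
theorem exists_polynomial_nonneg [FiniteDimensional ℝ V] (hm : ∀ f ∈ V, Measurable f)
    {f : ℝ → ℝ} (hf : f ∈ V) : ∃ p : ℝ[X], ∀ x, 0 ≤ x → f x = p.eval x := by
  obtain ⟨p, hp⟩ := hV.exists_polynomial_nat hm hf
  have hq : ∀ m q : ℕ, f (m / (q + 1 : ℕ)) = p.eval ((m : ℝ) / (q + 1 : ℕ)) := by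
    intro m q
    have hq : (0 : ℝ) < (q + 1 : ℕ) := by positivity
    obtain ⟨r, hr⟩ := hV.exists_polynomial_nat hm (hV.dilate_mem hf (inv_pos.2 hq))
    have : r.comp (C ((q + 1 : ℕ) : ℝ) * X) = p := by
      refine eq_of_forall_nat_eval_eq (c := 0) fun k _ => ?_
      have := hr ((q + 1) * k)
      rw [Nat.cast_mul, inv_mul_cancel_left₀ hq.ne', hp] at this
      simpa using this.symm
    have h2 := hr m
    rw [inv_mul_eq_div] at h2
    rw [h2, ← this]
    simp only [eval_comp, eval_mul, eval_C, eval_X]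
    rw [mul_div_cancel₀ _ hq.ne']
  refine ⟨p, fun x hx => ?_⟩
  have hl : Tendsto (fun n : ℕ => ((⌊x * (n + 1 : ℕ)⌋₊ : ℕ) : ℝ) / (n + 1 : ℕ)) atTop (𝓝 x) :=
    ((tendsto_nat_floor_mul_div_atTop hx).comp tendsto_natCast_atTop_atTop).comp
      (tendsto_add_atTop_nat 1)
  refine tendsto_nhds_unique (((hV.continuous hm hf).tendsto x).comp hl) ?_
  refine ((p.continuous.tendsto x).comp hl).congr fun n => ?_
  exact (hq _ n).symm

include hV in
/-- On `[0, ∞)` the function `f` and its translate `f (· + x)` are polynomials `p` and `q`; they are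
translates of each other far to the right, hence everywhere, so that `f x = q 0 = p x`. -/
theorem exists_polynomial [FiniteDimensional ℝ V] (hm : ∀ f ∈ V, Measurable f)
    {f : ℝ → ℝ} (hf : f ∈ V) : ∃ p : ℝ[X], ∀ x, f x = p.eval x := by
  obtain ⟨p, hp⟩ := hV.exists_polynomial_nonneg hm hf
  refine ⟨p, fun x => ?_⟩
  obtain ⟨q, hq⟩ := hV.exists_polynomial_nonneg hm (hV.shift_mem hf x)
  have : q = p.comp (X + C x) := by
    obtain ⟨c, hc⟩ := exists_nat_ge (-x)
    refine eq_of_forall_nat_eval_eq (c := c) fun m hcm => ?_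
    have hcm' : (c : ℝ) ≤ m := by exact_mod_cast hcm
    rw [← hq _ m.cast_nonneg, hp _ (by linarith)]
    simp
  have h0 := hq 0 le_rfl
  simpa [this] using h0

include hV in
/-- The monomials are eigenvectors of dilation by `2` with distinct eigenvalues `2 ^ k`, so a
polynomial in the dilation (here the Lagrange polynomial `q` that is `1` at `2 ^ k` and `0` at the
other eigenvalues) isolates a single term of `p`. -/
theorem pow_mem_of_coeff_ne_zero {p : ℝ[X]} (hp : (fun x => p.eval x) ∈ V) {k : ℕ}
    (hk : p.coeff k ≠ 0) : (fun x : ℝ => x ^ k) ∈ V := by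
  set s := Finset.range (p.natDegree + 1)
  have hks : k ∈ s := by
    simpa [s, Nat.lt_succ_iff] using Polynomial.le_natDegree_of_ne_zero hk
  have hinj : Set.InjOn (fun j : ℕ => (2 : ℝ) ^ j) s :=
    (pow_right_injective₀ (by norm_num) (by norm_num)).injOn
  set q : ℝ[X] := Lagrange.basis s (fun j : ℕ => (2 : ℝ) ^ j) k
  have hmem : (∑ i ∈ Finset.range (q.natDegree + 1),
      q.coeff i • fun x : ℝ => p.eval (2 ^ i * x)) ∈ V :=
    Submodule.sum_mem _ fun i _ => V.smul_mem _ (hV.dilate_mem hp (by positivity))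
  have heq : (∑ i ∈ Finset.range (q.natDegree + 1),
      q.coeff i • fun x : ℝ => p.eval (2 ^ i * x)) = p.coeff k • fun x : ℝ => x ^ k := by
    ext x
    have h1 : ∀ i, q.coeff i * p.eval (2 ^ i * x) =
        ∑ j ∈ s, p.coeff j * x ^ j * (q.coeff i * (2 ^ j) ^ i) := by
      intro i
      rw [Polynomial.eval_eq_sum_range, Finset.mul_sum]
      refine Finset.sum_congr rfl fun j _ => ?_
      rw [mul_pow, ← pow_mul, ← pow_mul, mul_comm i j]
      ring
    simp only [Finset.sum_apply, Pi.smul_apply, smul_eq_mul, h1]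
    rw [Finset.sum_comm]
    simp_rw [← Finset.mul_sum, ← Polynomial.eval_eq_sum_range]
    rw [Finset.sum_eq_single_of_mem k hks]
    · rw [Lagrange.eval_basis_self hinj hks, mul_one]
    · intro j hj hjk
      rw [Lagrange.eval_basis_of_ne hjk.symm hj, mul_zero]
  rw [heq] at hmem
  exact (V.smul_mem_iff hk).1 hmem

include hV in
/-- Every power below `L` occurs in `(x + 1) ^ L`, a translate of `x ^ L`. -/
theorem pow_mem_of_le {L k : ℕ} (hkL : k ≤ L) (hL : (fun x : ℝ => x ^ L) ∈ V) :
    (fun x : ℝ => x ^ k) ∈ V := by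
  refine hV.pow_mem_of_coeff_ne_zero (p := (X + 1) ^ L) ?_ (k := k) ?_
  · simpa using hV.shift_mem hL 1
  · rw [Polynomial.coeff_X_add_one_pow]
    exact_mod_cast (Nat.choose_pos hkL).ne'

include hV in
theorem lt_finrank_of_pow_mem [FiniteDimensional ℝ V] {L : ℕ} (hL : (fun x : ℝ => x ^ L) ∈ V) :
    L < Module.finrank ℝ V := by
  have h := (linearIndependent_pow_fun.comp (Fin.val : Fin (L + 1) → ℕ) Fin.val_injective)
  have h' : LinearIndependent ℝ fun l : Fin (L + 1) =>
      (⟨fun x : ℝ => x ^ (l : ℕ), hV.pow_mem_of_le (Nat.lt_succ_iff.1 l.2) hL⟩ : V) :=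
    LinearIndependent.of_comp V.subtype h
  simpa using h'.fintype_card_le_finrank

include hV in
/-- A finite-dimensional affine-invariant space of measurable functions that contains the constants
is the space of polynomials of degree at most some `L`. -/
theorem exists_eq_span_pow [FiniteDimensional ℝ V] (hm : ∀ f ∈ V, Measurable f) (h1 : 1 ∈ V) :
    ∃ L < Module.finrank ℝ V,
      V = Submodule.span ℝ (Set.range fun (l : Fin (L + 1)) (x : ℝ) => x ^ (l : ℕ)) := by
  set S : Set ℕ := {l | (fun x : ℝ => x ^ l) ∈ V}
  have hS0 : 0 ∈ S := by simpa [S, ← Pi.one_def] using h1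
  have hSb : BddAbove S := ⟨_, fun l hl => (hV.lt_finrank_of_pow_mem hl).le⟩
  have hL : sSup S ∈ S := Nat.sSup_mem ⟨0, hS0⟩ hSb
  refine ⟨sSup S, hV.lt_finrank_of_pow_mem hL, le_antisymm (fun f hf => ?_) ?_⟩
  · obtain ⟨p, hp⟩ := hV.exists_polynomial hm hf
    have hfp : f = ∑ j ∈ Finset.range (p.natDegree + 1), p.coeff j • fun x : ℝ => x ^ j := by
      ext x
      rw [hp, Polynomial.eval_eq_sum_range]
      simp
    rw [hfp]
    refine Submodule.sum_mem _ fun j _ => ?_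
    by_cases hj : p.coeff j = 0
    · simp [hj]
    refine Submodule.smul_mem _ _ (Submodule.subset_span ?_)
    have hjS : j ∈ S := hV.pow_mem_of_coeff_ne_zero (by rwa [← funext hp]) hj
    exact ⟨⟨j, Nat.lt_succ_iff.2 (le_csSup hSb hjS)⟩, rfl⟩
  · rw [Submodule.span_le]
    rintro _ ⟨l, rfl⟩
    exact hV.pow_mem_of_le (Nat.lt_succ_iff.1 l.2) hL

end AffineInvariant

end AffineInvariantSpaces

/-! ### A chain with three states -/

namespace MDP
variable {X A : Type} [MeasurableSpace X] [MeasurableSpace A]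

theorem map_eval_zero_trajLaw (M : MDP X A) (π : Kernel X A) [IsMarkovKernel π] (x : X) (a : A) :
    (M.trajLaw π x a).map (fun ω => ω 0) = (Measure.dirac (x, a)).prod (M.reward (x, a)) := by
  have h : (fun ω : ℕ → Step X A => ω 0) =
      (fun h : (Π _ : Finset.Iic 0, Step X A) => h ⟨0, Finset.mem_Iic.2 le_rfl⟩) ∘
        Preorder.frestrictLe 0 := rfl
  rw [h, ← Measure.map_map (by fun_prop) (by fun_prop), trajLaw, Kernel.trajMeasure,
    Measure.map_comp _ _ (by fun_prop), Kernel.traj_map_frestrictLe, Kernel.partialTraj_self,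
    Measure.id_comp, Measure.map_map (by fun_prop) (by fun_prop)]
  exact Measure.map_id

theorem map_eval_succ_trajLaw (M : MDP X A) (π : Kernel X A) [IsMarkovKernel π] (x : X) (a : A)
    (n : ℕ) : (M.trajLaw π x a).map (fun ω => ω (n + 1)) =
      ((M.trajLaw π x a).map fun ω => (ω n).1).bind (M.stepKernel π) := by
  have h := congrArg Measure.snd (Kernel.map_frestrictLe_trajMeasure_compProd_eq_map_trajMeasure
    (X := fun _ : ℕ => Step X A) (μ₀ := (Measure.dirac (x, a)).prod (M.reward (x, a)))
    (κ := M.historyKernel π) (a := n))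
  rw [Measure.snd_compProd, Measure.snd_map_prodMk (by fun_prop)] at h
  rw [trajLaw, ← h]
  ext s hs
  rw [Measure.bind_apply hs (Kernel.aemeasurable _), Measure.bind_apply hs (Kernel.aemeasurable _),
    lintegral_map (Kernel.measurable_coe _ hs) (by fun_prop),
    lintegral_map (Kernel.measurable_coe _ hs) (by fun_prop)]
  rfl

end MDP

/-- With deterministic transitions and a single action, a step from `x` leads to `next x`. -/
theorem stepKernel_eq_of_trans_eq_dirac {X : Type} [MeasurableSpace X] (M : MDP X Unit)
    (π : Kernel X Unit) [IsMarkovKernel π] {next : X → X}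
    (hM : ∀ x a, M.trans (x, a) = Measure.dirac (next x)) (x : X) (a : Unit) :
    M.stepKernel π (x, a) =
      (Measure.dirac (next x, ())).prod (M.reward (next x, ())) := by
  have hπ : ∀ y, π y = Measure.dirac () := fun y => by
    ext s hs
    rcases Set.eq_empty_or_nonempty s with rfl | ⟨u, hu⟩
    · simp
    · rw [Set.eq_univ_of_forall (s := s) fun v => hu]
      simp
  refine Measure.ext_of_lintegral _ fun f hf => ?_
  have hf' : Measurable fun y : X => ∫⁻ c, f ((y, ()), c) ∂M.reward (y, ()) :=
    Measurable.lintegral_kernel_prod_right' (κ := M.reward.comap (fun y : X => (y, ()))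
      (by fun_prop)) (f := fun p => f ((p.1, ()), p.2)) (by fun_prop)
  rw [MDP.stepKernel, Kernel.lintegral_compProd _ _ _ hf, Kernel.lintegral_compProd, hM]
  · simp only [Kernel.prodMkLeft_apply, hπ, lintegral_dirac]
    rw [lintegral_dirac' _ hf', lintegral_prod _ hf.aemeasurable, lintegral_dirac' _
      (hf.lintegral_prod_right')]
  · exact Measurable.lintegral_kernel_prod_right'
      (κ := Kernel.prodMkLeft (X × Unit) M.reward |>.comap (fun p : X × Unit => ((x, a), p))
        (by fun_prop)) (f := fun p => f p) hf

/-- With deterministic transitions and a single action, at time `t` the state is `next^[t] x` and the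
reward is drawn from its reward law. -/
theorem map_eval_trajLaw_of_trans_eq_dirac {X : Type} [MeasurableSpace X] (M : MDP X Unit)
    (π : Kernel X Unit) [IsMarkovKernel π] {next : X → X}
    (hM : ∀ x a, M.trans (x, a) = Measure.dirac (next x)) (x : X) (t : ℕ) :
    (M.trajLaw π x ()).map (fun ω => ω t) =
      (Measure.dirac (next^[t] x, ())).prod (M.reward (next^[t] x, ())) := by
  induction t with
  | zero => exact M.map_eval_zero_trajLaw π x ()
  | succ t ih =>
    have h : (M.trajLaw π x ()).map (fun ω => (ω t).1) = Measure.dirac (next^[t] x, ()) := by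
      have := congrArg Measure.fst ih
      rwa [Measure.fst_prod, Measure.fst, Measure.map_map (by fun_prop) (by fun_prop)] at this
    rw [M.map_eval_succ_trajLaw, h, Measure.dirac_bind (Kernel.measurable _),
      stepKernel_eq_of_trans_eq_dirac M π hM, Function.iterate_succ_apply']

/-- The chain `0 → 1 → 2 → 2 → ⋯` with a single action: reward `r` in state `0`, a reward of law `ν`
in state `1`, and no reward in the absorbing state `2`. Its returns from `0`, `1` and `2` are
distributed as `r + γ Z` with `Z ∼ ν`, as `ν`, and as the point mass at `0`. -/
noncomputable def chainMDP (r γ : ℝ) (hγ0 : 0 ≤ γ) (hγ1 : γ < 1) (ν : ProbabilityMeasure ℝ) :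
    MDP (Fin 3) Unit where
  trans := Kernel.ofFunOfCountable fun p => Measure.dirac (![1, 2, 2] p.1)
  reward := Kernel.ofFunOfCountable fun p =>
    ((![⟨Measure.dirac r, inferInstance⟩, ν, ⟨Measure.dirac 0, inferInstance⟩] p.1 :
      ProbabilityMeasure ℝ) : Measure ℝ)
  γ := γ
  γ_nonneg := hγ0
  γ_lt_one := hγ1
  markov_trans := ⟨fun _ => Measure.dirac.isProbabilityMeasure⟩
  markov_reward := ⟨fun _ => Subtype.property (_ : ProbabilityMeasure ℝ)⟩

section chainMDP

variable (r γ : ℝ) (hγ0 : 0 ≤ γ) (hγ1 : γ < 1) (ν : ProbabilityMeasure ℝ)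
  (π : Kernel (Fin 3) Unit) [IsMarkovKernel π]

theorem map_eval_trajLaw_chainMDP (x : Fin 3) (t : ℕ) :
    ((chainMDP r γ hγ0 hγ1 ν).trajLaw π x ()).map (fun ω => ω t) =
      (Measure.dirac ((![1, 2, 2] : Fin 3 → Fin 3)^[t] x, ())).prod
        ((chainMDP r γ hγ0 hγ1 ν).reward ((![1, 2, 2] : Fin 3 → Fin 3)^[t] x, ())) :=
  map_eval_trajLaw_of_trans_eq_dirac _ π (fun _ _ => rfl) x t

theorem map_rewardAt_trajLaw_chainMDP (x : Fin 3) (t : ℕ) :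
    ((chainMDP r γ hγ0 hγ1 ν).trajLaw π x ()).map (rewardAt t) =
        ((chainMDP r γ hγ0 hγ1 ν).reward ((![1, 2, 2] : Fin 3 → Fin 3)^[t] x, ())) := by
  have := congrArg Measure.snd (map_eval_trajLaw_chainMDP r γ hγ0 hγ1 ν π x t)
  rwa [Measure.snd_prod, Measure.snd, Measure.map_map (by fun_prop) (by fun_prop)] at this

theorem ae_rewardAt_eq_of_reward_eq_dirac {x : Fin 3} {t : ℕ} {c : ℝ}
    (h : (chainMDP r γ hγ0 hγ1 ν).reward ((![1, 2, 2] : Fin 3 → Fin 3)^[t] x, ()) =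
      Measure.dirac c) :
    ∀ᵐ ω ∂(chainMDP r γ hγ0 hγ1 ν).trajLaw π x (), rewardAt t ω = c := by
  have h1 := map_rewardAt_trajLaw_chainMDP r γ hγ0 hγ1 ν π x t
  rw [h] at h1
  have h2 : ∀ᵐ y ∂((chainMDP r γ hγ0 hγ1 ν).trajLaw π x ()).map (rewardAt t), y = c := by
    rw [h1, ae_dirac_eq]
    exact Filter.eventually_pure.2 rfl
  exact ae_of_ae_map (Measurable.aemeasurable (by unfold rewardAt; fun_prop)) h2

theorem iterate_chain_eq_two (x : Fin 3) (t : ℕ) :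
    (![1, 2, 2] : Fin 3 → Fin 3)^[t + 2] x = 2 := by
  have h2 : (![1, 2, 2] : Fin 3 → Fin 3)^[t] 2 = 2 := Function.iterate_fixed rfl t
  rw [Function.iterate_add_apply]
  fin_cases x <;> exact h2

theorem ae_rewardAt_eq_zero (x : Fin 3) :
    ∀ᵐ ω ∂(chainMDP r γ hγ0 hγ1 ν).trajLaw π x (), ∀ t, 2 ≤ t → rewardAt t ω = 0 := by
  refine ae_all_iff.2 fun t => ?_
  by_cases ht : 2 ≤ t
  · obtain ⟨t, rfl⟩ := Nat.exists_eq_add_of_le' ht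
    filter_upwards [ae_rewardAt_eq_of_reward_eq_dirac r γ hγ0 hγ1 ν π (x := x) (t := t + 2)
      (c := 0) (by rw [iterate_chain_eq_two]; rfl)] with ω hω _ using hω
  · simp [ht]

theorem returnConverges_chainMDP : (chainMDP r γ hγ0 hγ1 ν).ReturnConverges π := by
  rintro x ⟨⟩
  filter_upwards [ae_rewardAt_eq_zero r γ hγ0 hγ1 ν π x] with ω hω
  refine summable_of_ne_finset_zero (s := Finset.range 2) fun t ht => ?_
  rw [hω t (by simpa [Nat.succ_le_iff] using ht), mul_zero]

theorem ae_ret_eq (x : Fin 3) : ∀ᵐ ω ∂(chainMDP r γ hγ0 hγ1 ν).trajLaw π x (),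
    (chainMDP r γ hγ0 hγ1 ν).ret ω = rewardAt 0 ω + γ * rewardAt 1 ω := by
  filter_upwards [ae_rewardAt_eq_zero r γ hγ0 hγ1 ν π x] with ω hω
  rw [MDP.ret, tsum_eq_sum (s := Finset.range 2)]
  · simp [Finset.sum_range_succ, chainMDP]
  · intro t ht
    rw [hω t (by simpa [Nat.succ_le_iff] using ht), mul_zero]

theorem returnDist_chainMDP_two :
    (chainMDP r γ hγ0 hγ1 ν).returnDist π 2 () = ⟨Measure.dirac 0, inferInstance⟩ := by
  refine Subtype.ext ?_
  change Measure.map _ _ = Measure.dirac 0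
  rw [Measure.map_congr (g := fun _ => (0 : ℝ)), Measure.map_const]
  · simp
  filter_upwards [ae_ret_eq r γ hγ0 hγ1 ν π 2,
    ae_rewardAt_eq_of_reward_eq_dirac r γ hγ0 hγ1 ν π (x := 2) (t := 0) (c := 0) rfl,
    ae_rewardAt_eq_of_reward_eq_dirac r γ hγ0 hγ1 ν π (x := 2) (t := 1) (c := 0) rfl]
    with ω h h0 h1
  simp [h, h0, h1]

theorem returnDist_chainMDP_one :
    (chainMDP r γ hγ0 hγ1 ν).returnDist π 1 () = ν := by
  refine Subtype.ext ?_
  change Measure.map _ _ = (ν : Measure ℝ)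
  rw [Measure.map_congr (g := rewardAt 0), map_rewardAt_trajLaw_chainMDP]
  · rfl
  filter_upwards [ae_ret_eq r γ hγ0 hγ1 ν π 1,
    ae_rewardAt_eq_of_reward_eq_dirac r γ hγ0 hγ1 ν π (x := 1) (t := 1) (c := 0) rfl]
    with ω h h1
  simp [h, h1]

theorem returnDist_chainMDP_zero :
    (chainMDP r γ hγ0 hγ1 ν).returnDist π 0 () =
      ν.map (f := fun z => γ * z + r) (by fun_prop) := by
  refine Subtype.ext ?_
  change Measure.map _ _ = Measure.map _ (ν : Measure ℝ)
  have h : (ν : Measure ℝ) =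
      ((chainMDP r γ hγ0 hγ1 ν).trajLaw π 0 ()).map (rewardAt 1) := by
    rw [map_rewardAt_trajLaw_chainMDP]; rfl
  rw [h, Measure.map_map (by fun_prop) (by unfold rewardAt; fun_prop)]
  refine Measure.map_congr ?_
  filter_upwards [ae_ret_eq r γ hγ0 hγ1 ν π 0,
    ae_rewardAt_eq_of_reward_eq_dirac r γ hγ0 hγ1 ν π (x := 0) (t := 0) (c := r) rfl]
    with ω h h0
  simp [h, h0, add_comm]

theorem nextLaw_chainMDP {K : ℕ} (s : Fin K → Statistic) :
    nextLaw s (chainMDP r γ hγ0 hγ1 ν) π 0 () = Measure.dirac (r, statVec s ν) := by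
  rw [nextLaw, Measure.map_congr (g := fun _ => (r, statVec s ν)), Measure.map_const]
  · simp
  have hX : ∀ᵐ ω ∂(chainMDP r γ hγ0 hγ1 ν).trajLaw π 0 (), stateAt 1 ω = 1 := by
    have h1 := congrArg Measure.fst (map_eval_trajLaw_chainMDP r γ hγ0 hγ1 ν π 0 1)
    rw [Measure.fst_prod, Measure.fst, Measure.map_map (by fun_prop) (by fun_prop)] at h1
    have h2 : ∀ᵐ y ∂((chainMDP r γ hγ0 hγ1 ν).trajLaw π 0 ()).map
        (Prod.fst ∘ fun ω => ω 1), y.1 = 1 := by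
      rw [h1, ae_dirac_eq]
      exact Filter.eventually_pure.2 rfl
    exact ae_of_ae_map (Measurable.aemeasurable (by fun_prop)) h2
  filter_upwards [hX,
    ae_rewardAt_eq_of_reward_eq_dirac r γ hγ0 hγ1 ν π (x := 0) (t := 0) (c := r) rfl]
    with ω h h0
  rw [h0, h]
  congr
  exact returnDist_chainMDP_one r γ hγ0 hγ1 ν π

end chainMDP

/-- For Bellman closed statistics, the values at the law of `γ Z + r` depend on the law of `Z` only
through its values of the statistics, as `chainMDP` shows. -/
theorem BellmanClosed.statVec_map_affine_eq {K : ℕ} {s : Fin K → Statistic} (hs : BellmanClosed s)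
    {r γ : ℝ} (hγ0 : 0 ≤ γ) (hγ1 : γ < 1) {ν ν' : ProbabilityMeasure ℝ}
    (h0 : (⟨Measure.dirac 0, inferInstance⟩ : ProbabilityMeasure ℝ) ∈ commonDom s)
    (hν : ν ∈ commonDom s) (hν' : ν' ∈ commonDom s)
    (hm : ν.map (f := fun z => γ * z + r) (by fun_prop) ∈ commonDom s)
    (hm' : ν'.map (f := fun z => γ * z + r) (by fun_prop) ∈ commonDom s)
    (h : statVec s ν = statVec s ν') :
    statVec s (ν.map (f := fun z => γ * z + r) (by fun_prop)) =
      statVec s (ν'.map (f := fun z => γ * z + r) (by fun_prop)) := by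
  obtain ⟨T, hT⟩ := hs
  let π : Kernel (Fin 3) Unit := Kernel.const _ (Measure.dirac ())
  have key : ∀ μ : ProbabilityMeasure ℝ, μ ∈ commonDom s →
      μ.map (f := fun z => γ * z + r) (by fun_prop) ∈ commonDom s →
      statVec s (μ.map (f := fun z => γ * z + r) (by fun_prop)) =
        T γ (Measure.dirac (r, statVec s μ)) := by
    intro μ hμ hμm
    have := hT (Fin 3) Unit (chainMDP r γ hγ0 hγ1 μ) π
      (returnConverges_chainMDP r γ hγ0 hγ1 μ π) (by
      rintro x ⟨⟩
      fin_cases x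
      · exact (returnDist_chainMDP_zero r γ hγ0 hγ1 μ π).symm ▸ hμm
      · exact (returnDist_chainMDP_one r γ hγ0 hγ1 μ π).symm ▸ hμ
      · exact (returnDist_chainMDP_two r γ hγ0 hγ1 μ π).symm ▸ h0) 0 ()
    rwa [returnDist_chainMDP_zero, nextLaw_chainMDP] at this
  rw [key ν hν hm, key ν' hν' hm', h]

/-! ### Affine invariance of the span of Bellman closed statistics -/

/-- The measure with finitely many atoms that gives weight `w x` to each point `x` of `S`. Negative
weights are truncated to zero. -/
noncomputable def atomicMeasure (w : ℝ → ℝ) (S : Finset ℝ) : Measure ℝ :=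
  ∑ x ∈ S, ENNReal.ofReal (w x) • Measure.dirac x

theorem isProbabilityMeasure_atomicMeasure {w : ℝ → ℝ} {S : Finset ℝ} (hw : ∀ x, 0 ≤ w x)
    (h1 : ∑ x ∈ S, w x = 1) : IsProbabilityMeasure (atomicMeasure w S) := by
  constructor
  simp only [atomicMeasure, Measure.finsetSum_apply, Measure.smul_apply, measure_univ,
    smul_eq_mul, mul_one]
  rw [← ENNReal.ofReal_sum_of_nonneg fun x _ => hw x, h1, ENNReal.ofReal_one]

theorem integrable_atomicMeasure (w : ℝ → ℝ) (S : Finset ℝ) (f : ℝ → ℝ) :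
    Integrable f (atomicMeasure w S) :=
  integrable_finsetSum_measure.2 fun x _ =>
    (integrable_dirac (by simp)).smul_measure ENNReal.ofReal_ne_top

theorem integral_atomicMeasure {w : ℝ → ℝ} (hw : ∀ x, 0 ≤ w x) (S : Finset ℝ) (f : ℝ → ℝ) :
    ∫ z, f z ∂atomicMeasure w S = ∑ x ∈ S, w x * f x := by
  rw [atomicMeasure, integral_finsetSum_measure fun x _ =>
    (integrable_dirac (by simp)).smul_measure ENNReal.ofReal_ne_top]
  refine Finset.sum_congr rfl fun x _ => ?_
  rw [integral_smul_measure, integral_dirac, ENNReal.toReal_ofReal (hw x), smul_eq_mul]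

/-- If on finitely supported probability measures the expectation of `φ` is a function of the
expectations of `h₁, …, h_K`, then `φ` is a linear combination of `1, h₁, …, h_K`: functions on `ℝ`
are the linear forms on finitely supported signed measures, and a signed measure annihilated by
`1, h₁, …, h_K` is a multiple of the difference of two probability measures, its normalized
positive and negative parts. -/
theorem mem_span_of_forall_atomic {K : ℕ} {h : Fin K → ℝ → ℝ} {φ : ℝ → ℝ}
    (H : ∀ (S : Finset ℝ) (w w' : ℝ → ℝ), (∀ x, 0 ≤ w x) → (∀ x, 0 ≤ w' x) →
      ∑ x ∈ S, w x = 1 → ∑ x ∈ S, w' x = 1 →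
      (∀ k, ∑ x ∈ S, w x * h k x = ∑ x ∈ S, w' x * h k x) →
      ∑ x ∈ S, w x * φ x = ∑ x ∈ S, w' x * φ x) :
    φ ∈ Submodule.span ℝ (insert 1 (Set.range h)) := by
  -- the function with which a linear form integrates
  let B : ((ℝ →₀ ℝ) →ₗ[ℝ] ℝ) →ₗ[ℝ] ℝ → ℝ :=
    LinearMap.pi fun x => LinearMap.applyₗ (Finsupp.single x 1)
  have hB : ∀ f : ℝ → ℝ, B (Finsupp.linearCombination ℝ f) = f := fun f => by
    ext x
    simp [B]
  let g : Fin (K + 1) → ℝ → ℝ := Fin.cons 1 h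
  have hg : insert 1 (Set.range h) = Set.range g := (Fin.range_cons _ _).symm
  suffices hφ : Finsupp.linearCombination ℝ φ ∈
      Submodule.span ℝ (Set.range fun i => Finsupp.linearCombination ℝ (g i)) by
    have := Submodule.mem_map_of_mem (f := B) hφ
    rw [Submodule.map_span, ← Set.range_comp, hB] at this
    simpa only [Function.comp_def, hB, hg] using this
  refine mem_span_of_iInf_ker_le_ker fun c hc => ?_
  rw [Submodule.mem_iInf] at hc
  have hsum : ∀ f : ℝ → ℝ, Finsupp.linearCombination ℝ f c =
      ∑ x ∈ c.support, max (c x) 0 * f x - ∑ x ∈ c.support, max (-c x) 0 * f x := by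
    intro f
    rw [Finsupp.linearCombination_apply, Finsupp.sum, ← Finset.sum_sub_distrib]
    refine Finset.sum_congr rfl fun x _ => ?_
    rw [← sub_mul, max_zero_sub_max_neg_zero_eq_self, smul_eq_mul]
  have hbal : ∀ i, ∑ x ∈ c.support, max (c x) 0 * g i x =
      ∑ x ∈ c.support, max (-c x) 0 * g i x := fun i => by
    rw [← sub_eq_zero, ← hsum]
    exact hc i
  -- the common mass of the positive and the negative part; the case `i = 0` of `hbal`
  set m := ∑ x ∈ c.support, max (c x) 0
  have hm : ∑ x ∈ c.support, max (-c x) 0 = m := by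
    simpa [g, m] using (hbal 0).symm
  rw [LinearMap.mem_ker, hsum, sub_eq_zero]
  rcases (Finset.sum_nonneg fun x _ => le_max_right (c x) 0 : 0 ≤ m).eq_or_lt with h0 | h0
  · have h1 := (Finset.sum_eq_zero_iff_of_nonneg fun x _ => le_max_right (c x) 0).1 h0.symm
    have h2 := (Finset.sum_eq_zero_iff_of_nonneg fun x _ => le_max_right (-c x) 0).1
      (hm.trans h0.symm)
    exact Finset.sum_congr rfl fun x hx => by rw [h1 x hx, h2 x hx]
  · have h1 := H c.support (fun x => max (c x) 0 / m) (fun x => max (-c x) 0 / m)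
      (fun x => by positivity) (fun x => by positivity)
      (by rw [← Finset.sum_div, div_self h0.ne'])
      (by rw [← Finset.sum_div, hm, div_self h0.ne'])
      (fun k => by
        have := hbal k.succ
        simp only [g, Fin.cons_succ] at this
        simp_rw [div_mul_eq_mul_div, ← Finset.sum_div, this])
    simp_rw [div_mul_eq_mul_div, ← Finset.sum_div] at h1
    exact (div_left_inj' h0.ne').1 h1

/-- Invariance under contractions suffices for affine invariance: composition with a contraction is
injective on the finite-dimensional space `V`, hence bijective, which gives invariance under the
inverse map, and every increasing affine map is an expansion followed by a contraction. -/
theorem affineInvariant_of_contracting {V : Submodule ℝ (ℝ → ℝ)} [FiniteDimensional ℝ V]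
    (hV : ∀ f ∈ V, ∀ γ : ℝ, 0 < γ → γ < 1 → ∀ r : ℝ, (fun x => f (γ * x + r)) ∈ V) :
    AffineInvariant V := by
  have expand : ∀ f ∈ V, ∀ a : ℝ, 1 < a → ∀ b : ℝ, (fun x => f (a * x + b)) ∈ V := by
    intro f hf a ha b
    have ha0 : 0 < a := one_pos.trans ha
    let S : Module.End ℝ V := (LinearMap.funLeft ℝ ℝ fun x : ℝ => a⁻¹ * x + -(b / a)).restrict
      fun f hf => hV f hf a⁻¹ (inv_pos.2 ha0) (inv_lt_one_of_one_lt₀ ha) _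
    have hS : ∀ (g : V) (x : ℝ), (S g).1 (a * x + b) = g.1 x := by
      intro g x
      change g.1 (a⁻¹ * (a * x + b) + -(b / a)) = g.1 x
      rw [show a⁻¹ * (a * x + b) + -(b / a) = x by field_simp; ring]
    have hinj : Function.Injective S := fun g g' hg => by
      ext x
      rw [← hS g, ← hS g', hg]
    obtain ⟨g, hg⟩ := LinearMap.injective_iff_surjective.1 hinj ⟨f, hf⟩
    have : (fun x => f (a * x + b)) = g.1 := by
      ext x
      rw [← hS g x, hg]
    rw [this]
    exact g.2
  refine ⟨fun f hf a ha b => ?_⟩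
  -- expand by `a + 1` and contract by `a / (a + 1)`
  have h1 := hV _ (expand f hf (a + 1) (by linarith) b) (a / (a + 1)) (by positivity)
    ((div_lt_one (by linarith)).2 (by linarith)) 0
  convert h1 using 3
  field_simp
  ring

/-- Bellman closedness makes the span of `1, h₁, …, h_K` affine invariant: the expectation of
`h_k (γ z + r)` is determined by those of `h₁, …, h_K`, by `BellmanClosed.statVec_map_affine_eq`. -/
theorem BellmanClosed.affineInvariant_span {K : ℕ} {h : Fin K → ℝ → ℝ}
    (hh : ∀ k, Measurable (h k)) (hB : BellmanClosed fun k => Statistic.expectation (h k)) :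
    AffineInvariant (Submodule.span ℝ (insert 1 (Set.range h))) := by
  have : FiniteDimensional ℝ (Submodule.span ℝ (insert 1 (Set.range h))) :=
    FiniteDimensional.span_of_finite ℝ ((Set.finite_range h).insert 1)
  refine affineInvariant_of_contracting fun f hf γ hγ0 hγ1 r => ?_
  have key : ∀ k, (fun x => h k (γ * x + r)) ∈ Submodule.span ℝ (insert 1 (Set.range h)) := by
    intro k
    refine mem_span_of_forall_atomic fun S w w' hw hw' h1 h1' hww => ?_
    let ν : ProbabilityMeasure ℝ := ⟨_, isProbabilityMeasure_atomicMeasure hw h1⟩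
    let ν' : ProbabilityMeasure ℝ := ⟨_, isProbabilityMeasure_atomicMeasure hw' h1'⟩
    have hmap : ∀ (μ : ProbabilityMeasure ℝ) (k : Fin K),
        ∫ z, h k z ∂(μ.map (f := fun z => γ * z + r) (by fun_prop) : Measure ℝ) =
          ∫ z, h k (γ * z + r) ∂(μ : Measure ℝ) := fun μ k =>
      integral_map (by fun_prop) (hh k).aestronglyMeasurable
    have hdom : ∀ (μ : ProbabilityMeasure ℝ) (k : Fin K),
        Integrable (fun z => h k (γ * z + r)) (μ : Measure ℝ) →
        Integrable (h k) (μ.map (f := fun z => γ * z + r) (by fun_prop) : Measure ℝ) :=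
      fun μ k hi => (integrable_map_measure (hh k).aestronglyMeasurable (by fun_prop)).2 hi
    have h2 := hB.statVec_map_affine_eq (r := r) hγ0.le hγ1 (ν := ν) (ν' := ν')
      (fun k => integrable_dirac (by simp))
      (fun k => integrable_atomicMeasure w S _) (fun k => integrable_atomicMeasure w' S _)
      (fun k => hdom ν k (integrable_atomicMeasure w S _))
      (fun k => hdom ν' k (integrable_atomicMeasure w' S _))
      (funext fun k => by
        change ∫ z, h k z ∂atomicMeasure w S = ∫ z, h k z ∂atomicMeasure w' S
        rw [integral_atomicMeasure hw, integral_atomicMeasure hw', hww])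
    have h3 : ∫ z, h k z ∂(ν.map (f := fun z => γ * z + r) (by fun_prop) : Measure ℝ) =
      ∫ z, h k z ∂(ν'.map (f := fun z => γ * z + r) (by fun_prop) : Measure ℝ) := congrFun h2 k
    rw [hmap, hmap] at h3
    change ∫ z, h k (γ * z + r) ∂atomicMeasure w S =
      ∫ z, h k (γ * z + r) ∂atomicMeasure w' S at h3
    rwa [integral_atomicMeasure hw S fun z => h k (γ * z + r),
      integral_atomicMeasure hw' S fun z => h k (γ * z + r)] at h3
  have hle : Submodule.span ℝ (insert 1 (Set.range h)) ≤
      (Submodule.span ℝ (insert 1 (Set.range h))).comap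
        (LinearMap.funLeft ℝ ℝ fun x => γ * x + r) := by
    rw [Submodule.span_le, Set.insert_subset_iff]
    refine ⟨Submodule.subset_span (Set.mem_insert _ _), ?_⟩
    rintro _ ⟨k, rfl⟩
    exact key k
  exact hle hf

/-! ### From function spaces to spaces of functionals -/

/-- Integration against the measures of `D` is linear on functions that are integrable under all of
them, so it maps linear combinations of functions to linear combinations of functionals on `D`. -/
theorem integral_mem_span {ι : Type*} {D : Set (ProbabilityMeasure ℝ)} {f : ι → ℝ → ℝ}
    (hf : ∀ i, ∀ μ ∈ D, Integrable (f i) (μ : Measure ℝ)) {g : ℝ → ℝ}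
    (hg : g ∈ Submodule.span ℝ (Set.range f)) :
    (∀ μ ∈ D, Integrable g (μ : Measure ℝ)) ∧
      (fun μ : D => ∫ z, g z ∂((μ : ProbabilityMeasure ℝ) : Measure ℝ)) ∈
        Submodule.span ℝ
          (Set.range fun i (μ : D) => ∫ z, f i z ∂((μ : ProbabilityMeasure ℝ) : Measure ℝ)) := by
  induction hg using Submodule.span_induction with
  | mem g hg =>
    obtain ⟨i, rfl⟩ := hg
    exact ⟨hf i, Submodule.subset_span ⟨i, rfl⟩⟩
  | zero =>
    refine ⟨fun μ _ => integrable_zero _ _ _, ?_⟩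
    convert Submodule.zero_mem _
    simp
  | add g g' _ _ h h' =>
    refine ⟨fun μ hμ => (h.1 μ hμ).add (h'.1 μ hμ), ?_⟩
    convert Submodule.add_mem _ h.2 h'.2 using 1
    ext μ
    exact integral_add (h.1 μ μ.2) (h'.1 μ μ.2)
  | smul c g _ h =>
    refine ⟨fun μ hμ => (h.1 μ hμ).smul c, ?_⟩
    convert Submodule.smul_mem _ c h.2 using 1
    ext μ
    exact integral_smul c g

end DistRL

theorem theorem1 (K : ℕ) (h : Fin K → ℝ → ℝ) (hh : ∀ k, Measurable (h k))
    (hB : DistRL.BellmanClosed fun k => DistRL.Statistic.expectation (h k)) :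
    ∃ L : ℕ, L ≤ K ∧
      DistRL.commonDom (fun k => DistRL.Statistic.expectation (h k)) =
        DistRL.commonDom (fun l : Fin (L + 1) => DistRL.Statistic.moment l) ∧
      Submodule.span ℝ
          (insert 1 (Set.range (DistRL.functionalsOn
            (DistRL.commonDom fun k => DistRL.Statistic.expectation (h k))
            fun k => DistRL.Statistic.expectation (h k)))) =
        Submodule.span ℝ
          (Set.range (DistRL.functionalsOn
            (DistRL.commonDom fun k => DistRL.Statistic.expectation (h k))
            fun l : Fin (L + 1) => DistRL.Statistic.moment l)) := by
  -- `V` is kept opaque: it is a span of a set, of a family, and of monomials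
  obtain ⟨V, hVdef⟩ : ∃ V, V = Submodule.span ℝ (insert 1 (Set.range h)) := ⟨_, rfl⟩
  have hVc : V = Submodule.span ℝ (Set.range (Fin.cons 1 h : Fin (K + 1) → ℝ → ℝ)) := by
    rw [hVdef, Fin.range_cons]
  have hfV : ∀ i, (Fin.cons 1 h : Fin (K + 1) → ℝ → ℝ) i ∈ V := fun i =>
    hVc ▸ Submodule.subset_span ⟨i, rfl⟩
  have : FiniteDimensional ℝ V :=
    hVdef ▸ FiniteDimensional.span_of_finite ℝ ((Set.finite_range h).insert 1)
  have hVm : ∀ f ∈ V, Measurable f := fun f hf => by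
    rw [hVdef] at hf
    induction hf using Submodule.span_induction with
    | mem f hf =>
      rcases hf with rfl | ⟨k, rfl⟩
      · exact measurable_one
      · exact hh k
    | zero => exact measurable_zero
    | add f g _ _ hf hg => exact hf.add hg
    | smul c f _ hf => exact hf.const_smul c
  have hVa : DistRL.AffineInvariant V := hVdef ▸ hB.affineInvariant_span hh
  obtain ⟨L, hL, hVL⟩ := hVa.exists_eq_span_pow hVm (hfV 0)
  have hrank : Module.finrank ℝ V ≤ K + 1 := by
    have := finrank_range_le_card (R := ℝ) (Fin.cons 1 h : Fin (K + 1) → ℝ → ℝ)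
    rwa [Set.finrank, ← hVc, Fintype.card_fin] at this
  set D := DistRL.commonDom fun k => DistRL.Statistic.expectation (h k) with hD
  have hi : ∀ i, ∀ μ ∈ D, Integrable ((Fin.cons 1 h : Fin (K + 1) → ℝ → ℝ) i) (μ : Measure ℝ) := by
    intro i μ hμ
    induction i using Fin.cases with
    | zero => exact integrable_const (1 : ℝ)
    | succ k => exact hμ k
  have hpow : ∀ l : Fin (L + 1), (fun x : ℝ => x ^ (l : ℕ)) ∈ V := fun l =>
    hVL.symm ▸ Submodule.subset_span ⟨l, rfl⟩
  have hDL : D = DistRL.commonDom (fun l : Fin (L + 1) => DistRL.Statistic.moment l) := by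
    refine Set.Subset.antisymm (fun μ hμ l => (DistRL.integral_mem_span hi (hVc ▸ hpow l)).1 μ hμ)
      fun μ hμ k => ?_
    exact (DistRL.integral_mem_span (D := {μ}) (f := fun (l : Fin (L + 1)) (x : ℝ) => x ^ (l : ℕ))
      (by rintro l _ rfl; exact hμ l)
      (hVL ▸ hfV k.succ)).1 μ rfl
  refine ⟨L, by omega, hDL, ?_⟩
  have hcons : insert 1 (Set.range (DistRL.functionalsOn D
      fun k => DistRL.Statistic.expectation (h k))) =
      Set.range fun i (μ : D) => ∫ z, (Fin.cons 1 h : Fin (K + 1) → ℝ → ℝ) i z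
        ∂((μ : ProbabilityMeasure ℝ) : Measure ℝ) := by
    ext F
    simp only [Set.mem_insert_iff, Set.mem_range, Fin.exists_fin_succ, Fin.cons_zero,
      Fin.cons_succ, Pi.one_apply, integral_const, probReal_univ, smul_eq_mul, mul_one]
    exact or_congr eq_comm Iff.rfl
  rw [hcons]
  refine le_antisymm (Submodule.span_le.2 ?_) (Submodule.span_le.2 ?_)
  · rintro _ ⟨i, rfl⟩
    refine (DistRL.integral_mem_span (D := D)
      (f := fun (l : Fin (L + 1)) (x : ℝ) => x ^ (l : ℕ)) (fun l μ hμ => ?_) (hVL ▸ hfV i)).2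
    rw [hDL] at hμ
    exact hμ l
  · rintro _ ⟨l, rfl⟩
    exact (DistRL.integral_mem_span hi (hVc ▸ hpow l)).2
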